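/- **Setting.** Let $\mathcal L$ be a Hausdorff, first countable $n$-dimensional lamination (a space with a maximal atlas of charts in a fixed deck $\mathbb R^n\times S$ whose transitions carry connected cards $O\times\{t\}$ to cards) with a dense leaf $L\ni x$. Let $p:\widetilde L\to L$ be the universal cover of $L$ in its leaf topology, let $\tilde x$ lie over $x$, and let $G$ (the diophantine group) act on $\widetilde L$ by homeomorphisms. Let $T\ni x$ be a complete open transversal such that any two points of $\widetilde L$ over $T\cap L$ differ by an element of $G$. (Suspensions, quasisuspensions, double coset foliations and locally free Lie group actions give such data.) Fix an ultrafilter $\mathfrak U$ on $\mathbb N$ all of whose elements are infinite, and let ${}^*G$ be the ultrapower of $G$. *Fundamental germ.* ${}^*\mathsf D\subset{}^*G$ is the set of classes of sequences $(g_\alpha)$ such that $g_\alpha\tilde x$ lies over $T$ and projects to a sequence converging to $x$; put $\pi={}^*\mathsf D\cdot({}^*\mathsf D)^{-1}$ (the fundamental germ $[\![\pi]\!]_1(\mathcal L,x)$). *Germ universal cover.* A sequence in $\widetilde L$ is convergent if its projection converges in $\mathcal L$. Two convergent sequences are asymptotic if their projections have the same limit $\hat x$ and if, for every flow box about $\hat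 x$, their terms lie in a common lift of a plaque of this flow box for $\mathfrak U$-almost all indices. $[\mathcal L]$ is the set of asymptotic classes, and $\lim:[\mathcal L]\to\mathcal L$ takes the limit. Two classes lie on a common plaque over a flow box if their limits lie on a common plaque of it and they have representatives lying, for $\mathfrak U$-almost all indices, in common lifts of plaques of it. These plaques generate the leaf topology of $[\mathcal L]$, whose connected components are the leaves. An element $u\in\pi$ acts on a class $a$ if for some representatives the sequence $(u_\alpha\tilde x_\alpha)$ is convergent with limit $\lim a$; its class is then $u\cdot a$. The germ $\pi$ is *a group* if it is closed under multiplication, each $u\in\pi$ is a well-defined map on all of $[\mathcal L]$, and products act by composition. It is *tame* if $\lim a=\lim b$ implies $b=u\cdot a$ for some $u\in\pi$. *Topologies.* Suppose $\pi$ is tame and a group. Let $\tau$ be a germ universal cover topology on $[\mathcal L]$ on which $\pi$ acts by homeomorphisms. That is, locally $\tau$ consists of sheets which $\lim$ maps homeomorphically onto flow boxes and which carry the plaques of $[\mathcal L]$; and over some complete open transversal $T_0$ there is a continuous section $i:T_0\to[\mathcal L]$ of $\lim$, meeting each leaf at most once, such that $\lim^{-1}(T_0)$ is the disjoint union of the translates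 $u\cdot i(T_0)$, $u\in\pi$, and $u\cdot i(t)=u'\cdot i(t)$ only if $u=u'$. Let $\mathsf C$ be a normal subgroup of $\pi$, $\mathcal L_{\mathsf C}=\mathsf C\backslash[\mathcal L]$, and let $P_{\mathsf C}:\mathcal L_{\mathsf C}\to\mathcal L$ be the map induced by $\lim$. Let $\sigma$ be a *covering topology*: a topology on $[\mathcal L]$ maximal, with respect to inclusion, among those for which 1. $\mathcal L_{\mathsf C}$, with the quotient topology, has a (possibly non-Hausdorff) lamination structure whose leaf topology is the quotient of that of $[\mathcal L]$, in which every leaf over $L$ is dense, and for which $P_{\mathsf C}$ is a lamination map; 2. for no complete open transversal of $\mathcal L_{\mathsf C}$ does its preimage in $[\mathcal L]$ contain an orbit of $\mathsf C$ as an open subset; 3. every open set is $\tau$-open, and $\pi$ acts by homeomorphisms. Suppose that $\mathcal L_{\mathsf C}$ with the topology induced by $\sigma$ is Hausdorff, and give it a lamination structure with the leaf topology of (1). Let $\mathsf{Aut}(P_{\mathsf C})$ be the group of the homeomorphisms $F$ of $\mathcal L_{\mathsf C}$ with $P_{\mathsf C}\circ F=P_{\mathsf C}$ that carry leaves homeomorphically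 onto leaves and transversals onto transversals, and that are geometric: $F$ is covered by a homeomorphism $\Phi$ of $([\mathcal L],\sigma)$ with $\Phi(c\cdot a)=f(c)\cdot\Phi(a)$ for some automorphism $f$ of $\mathsf C$ and all $c\in\mathsf C$, $a\in[\mathcal L]$. **Theorem.** The action $\mathsf C a\mapsto\mathsf C(u\cdot a)$ of $\pi$ on $\mathcal L_{\mathsf C}$ induces an isomorphism $\pi/\mathsf C\cong\mathsf{Aut}(P_{\mathsf C})$. Moreover $P_{\mathsf C}$ induces a homeomorphism from the quotient of $\mathcal L_{\mathsf C}$ by this group onto $\mathcal L$. -/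

import Mathlib

open Set Filter Topology

namespace GermLam

universe u v w

/-- The horizontal factor `ℝⁿ` of a deck of cards `ℝⁿ × S`. -/
abbrev Horiz (n : ℕ) : Type := EuclideanSpace ℝ (Fin n)

/-! ### Laminations -/

section Lamination

variable {n : ℕ}

/-- The transition from the chart `φ` to the chart `ψ` carries every connected card `O × {t}` of its
domain onto a card.  (Cards with a disconnected base may be carried to several cards; the continuous
dependence of the transition on `t` is part of its being a homeomorphism.) -/
def CardCompatible {X : Type u} [TopologicalSpace X] {S : Type v} [TopologicalSpace S]
    (φ ψ : OpenPartialHomeomorph X (Horiz n × S)) : Prop :=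
  ∀ (O : Set (Horiz n)) (t : S), IsOpen O → IsPreconnected O →
    O ×ˢ {t} ⊆ (φ.symm.trans ψ).source →
    ∃ (O' : Set (Horiz n)) (t' : S), IsOpen O' ∧ (φ.symm.trans ψ) '' (O ×ˢ {t}) = O' ×ˢ {t'}

/-- An `n`-dimensional lamination structure on a topological space: a maximal atlas of charts with
values in a fixed deck of cards `ℝⁿ × S`, whose transitions carry cards to cards.  No separation
property is built in. -/
structure Lamination (n : ℕ) (X : Type u) (top : TopologicalSpace X) where
  /-- the transverse model -/
  S : Type u
  topS : TopologicalSpace S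
  atlas : Set (OpenPartialHomeomorph X (Horiz n × S))
  cover : ∀ x : X, ∃ φ ∈ atlas, x ∈ φ.source
  compatible : ∀ φ ∈ atlas, ∀ ψ ∈ atlas, CardCompatible φ ψ
  maximal : ∀ φ : OpenPartialHomeomorph X (Horiz n × S),
    (∀ ψ ∈ atlas, CardCompatible φ ψ ∧ CardCompatible ψ φ) → φ ∈ atlas

attribute [instance] Lamination.topS

variable {X : Type u} {top : TopologicalSpace X}

/-- A flow box `φ⁻¹(O × T')`, with `O` an open ball of `ℝⁿ` and `T'` open in the transverse
model. -/
structure Lamination.FlowBox (𝓛 : Lamination n X top) where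
  φ : OpenPartialHomeomorph X (Horiz n × 𝓛.S)
  mem_atlas : φ ∈ 𝓛.atlas
  center : Horiz n
  radius : ℝ
  radius_pos : 0 < radius
  T' : Set 𝓛.S
  isOpen_T' : IsOpen T'
  subset_target : Metric.ball center radius ×ˢ T' ⊆ φ.target

/-- The points of a flow box. -/
def Lamination.FlowBox.carrier {𝓛 : Lamination n X top} (B : 𝓛.FlowBox) : Set X :=
  B.φ.symm '' (Metric.ball B.center B.radius ×ˢ B.T')

/-- The plaque of a flow box at height `t`. -/
def Lamination.FlowBox.plaque {𝓛 : Lamination n X top} (B : 𝓛.FlowBox) (t : 𝓛.S) : Set X :=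
  B.φ.symm '' (Metric.ball B.center B.radius ×ˢ {t})

/-- The leaf topology, generated by the plaques: the space becomes the disjoint union of its
leaves, each with its topology of an `n`-manifold. -/
@[reducible] def Lamination.leafTopology (𝓛 : Lamination n X top) : TopologicalSpace X :=
  TopologicalSpace.generateFrom {P | ∃ B : 𝓛.FlowBox, ∃ t ∈ B.T', P = B.plaque t}

/-- The leaf through a point: a maximal continuation of overlapping plaques. -/
def Lamination.leaf (𝓛 : Lamination n X top) (x : X) : Set X :=
  @connectedComponent X 𝓛.leafTopology x

/-- Open transversals `φ⁻¹({a} × T')`. -/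
def Lamination.IsTransversal (𝓛 : Lamination n X top) (T : Set X) : Prop :=
  ∃ φ ∈ 𝓛.atlas, ∃ (a : Horiz n) (T' : Set 𝓛.S), IsOpen T' ∧ {a} ×ˢ T' ⊆ φ.target ∧
    T = φ.symm '' ({a} ×ˢ T')

/-- A transversal is complete if it meets every leaf. -/
def Lamination.IsComplete (𝓛 : Lamination n X top) (T : Set X) : Prop :=
  ∀ x : X, (𝓛.leaf x ∩ T).Nonempty

/-- Lamination maps: continuous maps that carry leaves into leaves and, locally, transversals into
transversals. -/
structure IsLaminationMap {Y : Type v} {topY : TopologicalSpace Y}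
    (𝓛 : Lamination n X top) (𝓜 : Lamination n Y topY) (F : X → Y) : Prop where
  continuous : Continuous F
  leaf_to_leaf : ∀ x : X, F '' 𝓛.leaf x ⊆ 𝓜.leaf (F x)
  transversal : ∀ x : X, ∃ T T', 𝓛.IsTransversal T ∧ x ∈ T ∧ 𝓜.IsTransversal T' ∧ F x ∈ T' ∧
    F '' T ⊆ T'

end Lamination

/-! ### The fundamental germ -/

/-- A weakly minimal lamination on `X` together with the data that enter its fundamental germ: an
ultrafilter on `ℕ` all of whose elements are infinite, a dense leaf `L` with universal cover
`p : Lt → L` (for the leaf topology), a group `G` (the diophantine group) acting on `Lt` by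
homeomorphisms, a point `xt` of `Lt` over the base point `p xt` of `L`, and a diophantine
transversal `T` through the base point.  Suspensions, quasisuspensions, double coset foliations
and locally free Lie group actions provide such data. -/
structure GermData (n : ℕ) (X : Type u) [top : TopologicalSpace X] (Lt : Type v) [TopologicalSpace Lt]
    (G : Type w) [Group G] [MulAction G Lt] where
  U : Ultrafilter ℕ
  infinite_of_mem : ∀ A ∈ U, A.Infinite
  lam : Lamination n X top
  p : Lt → X
  xt : Lt
  simplyConnected : SimplyConnectedSpace Lt
  covering : @IsCoveringMapOn Lt X _ lam.leafTopology p (lam.leaf (p xt))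
  range_eq : range p = lam.leaf (p xt)
  dense_leaf : Dense (lam.leaf (p xt))
  continuous_smul : ∀ g : G, Continuous fun y : Lt => g • y
  T : Set X
  isTransversal : lam.IsTransversal T
  isComplete : lam.IsComplete T
  mem_T : p xt ∈ T
  diophantine : ∀ y z : Lt, p y ∈ T → p z ∈ T → ∃ g : G, z = g • y

namespace GermData

variable {n : ℕ} {X : Type u} [top : TopologicalSpace X] {Lt : Type v} [TopologicalSpace Lt]
  {G : Type w} [Group G] [MulAction G Lt]

/-- The ultrapower `*G`. -/
abbrev StarG (D : GermData n X Lt G) : Type w := (D.U : Filter ℕ).Germ G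

/-- The classes in `*G` of the diophantine approximations of the base point along `T` based at
`xt`: sequences `g` with `g α • xt` over `T` and converging to the base point. -/
def dioph (D : GermData n X Lt G) : Set D.StarG :=
  {a | ∃ g : ℕ → G, (g : D.StarG) = a ∧ (∀ α, D.p (g α • D.xt) ∈ D.T) ∧
    Tendsto (fun α => D.p (g α • D.xt)) atTop (𝓝 (D.p D.xt))}

/-- The fundamental germ `*D · *D⁻¹`. -/
def germ (D : GermData n X Lt G) : Set D.StarG :=
  {a | ∃ g ∈ D.dioph, ∃ h ∈ D.dioph, a = g * h⁻¹}

/-! ### The germ universal cover -/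

/-- Sequences in `Lt` whose projection converges in the lamination. -/
def ConvSeq (D : GermData n X Lt G) : Type v :=
  {s : ℕ → Lt // ∃ x : X, Tendsto (fun α => D.p (s α)) atTop (𝓝 x)}

/-- `y` and `z` lie in a common lift of a plaque of the flow box `B` (the lifts of a plaque are the
path components of its preimage in `Lt`). -/
def CommonLift (D : GermData n X Lt G) (B : D.lam.FlowBox) (y z : Lt) : Prop :=
  ∃ t ∈ B.T', JoinedIn (D.p ⁻¹' B.plaque t) y z

/-- Asymptotic convergent sequences: the projections converge to the same point `x`, and for every
flow box about `x` the two sequences lie, for `U`-almost all indices, in a common lift of a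
plaque. -/
def Asymptotic (D : GermData n X Lt G) (s s' : D.ConvSeq) : Prop :=
  ∃ x : X, Tendsto (fun α => D.p (s.1 α)) atTop (𝓝 x) ∧
    Tendsto (fun α => D.p (s'.1 α)) atTop (𝓝 x) ∧
    ∀ B : D.lam.FlowBox, x ∈ B.carrier → ∀ᶠ α in (D.U : Filter ℕ), D.CommonLift B (s.1 α) (s'.1 α)

lemma flowBox_isOpen {𝓛 : Lamination n X top} (B : 𝓛.FlowBox) : IsOpen B.carrier :=
  B.φ.isOpen_image_symm_of_subset_target (Metric.isOpen_ball.prod B.isOpen_T') B.subset_target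

lemma U_le (D : GermData n X Lt G) : (D.U : Filter ℕ) ≤ atTop := by
  rw [← Nat.cofinite_eq_atTop]
  intro A hA
  by_contra h
  exact D.infinite_of_mem Aᶜ (Ultrafilter.compl_mem_iff_notMem.2 h) (mem_cofinite.1 hA)

lemma CommonLift.trans {D : GermData n X Lt G} {B : D.lam.FlowBox} {a b c : Lt}
    (h : D.CommonLift B a b) (h' : D.CommonLift B b c) : D.CommonLift B a c := by
  obtain ⟨t, ht, j⟩ := h
  obtain ⟨t', ht', j'⟩ := h'
  obtain ⟨⟨q, r⟩, ⟨hq, hr⟩, e⟩ := j.target_mem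
  obtain ⟨⟨q', r'⟩, ⟨hq', hr'⟩, e'⟩ := j'.source_mem
  simp only [mem_singleton_iff] at hr hr'
  subst hr hr'
  have := B.φ.symm.injOn (B.subset_target ⟨hq, ht⟩) (B.subset_target ⟨hq', ht'⟩) (e.trans e'.symm)
  rw [Prod.mk.injEq] at this
  obtain ⟨-, rfl⟩ := this
  exact ⟨_, ht, j.trans j'⟩

variable [T2Space X]

/-- The relation of being asymptotic is an equivalence relation. -/
def asympSetoid (D : GermData n X Lt G) : Setoid D.ConvSeq where
  r := D.Asymptotic
  iseqv :=
    { refl := fun s => by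
        obtain ⟨x, hx⟩ := s.2
        refine ⟨x, hx, hx, fun B hB => ?_⟩
        have := D.U_le (hx ((flowBox_isOpen B).mem_nhds hB))
        filter_upwards [this] with α hα
        obtain ⟨⟨q, r⟩, ⟨hq, hr⟩, e⟩ := hα
        exact ⟨r, hr, JoinedIn.refl ⟨(q, r), ⟨hq, rfl⟩, e⟩⟩
      symm := by
        rintro s s' ⟨x, h, h', H⟩
        refine ⟨x, h', h, fun B hB => ?_⟩
        filter_upwards [H B hB] with α hα
        obtain ⟨t, ht, j⟩ := hα
        exact ⟨t, ht, j.symm⟩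
      trans := by
        rintro s s' s'' ⟨x, h, h', H⟩ ⟨y, k, k', K⟩
        obtain rfl := tendsto_nhds_unique h' k
        refine ⟨x, h, k', fun B hB => ?_⟩
        filter_upwards [H B hB, K B hB] with α hα hα'
        exact hα.trans hα' }

/-- The germ universal cover: asymptotic classes of convergent sequences. -/
def Cover (D : GermData n X Lt G) : Type v := Quotient D.asympSetoid

/-- The class of a convergent sequence. -/
def cls (D : GermData n X Lt G) (s : D.ConvSeq) : D.Cover := Quotient.mk D.asympSetoid s

/-- The projection of the germ universal cover onto the lamination: the limit of a class. -/
noncomputable def lim (D : GermData n X Lt G) : D.Cover → X :=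
  Quotient.lift (fun s : D.ConvSeq => s.2.choose) (by
    rintro s s' ⟨x, h, h', -⟩
    exact (tendsto_nhds_unique s.2.choose_spec h).trans
      (tendsto_nhds_unique s'.2.choose_spec h').symm)

/-- The plaque of the germ universal cover through `a` over the flow box `B`: the classes `b` whose
limit lies in the same plaque of `B` as that of `a`, and that are represented by a sequence which
lies with one representing `a` in common lifts of plaques of `B`, for `U`-almost all indices. -/
def plaque (D : GermData n X Lt G) (B : D.lam.FlowBox) (a : D.Cover) : Set D.Cover :=
  {b | (∃ t ∈ B.T', D.lim a ∈ B.plaque t ∧ D.lim b ∈ B.plaque t) ∧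
    ∃ s s' : D.ConvSeq, D.cls s = a ∧ D.cls s' = b ∧
      ∀ᶠ α in (D.U : Filter ℕ), D.CommonLift B (s.1 α) (s'.1 α)}

/-- The leaf topology of the germ universal cover, generated by its plaques. -/
@[reducible] def leafTop (D : GermData n X Lt G) : TopologicalSpace D.Cover :=
  TopologicalSpace.generateFrom {P | ∃ (B : D.lam.FlowBox) (a : D.Cover),
    D.lim a ∈ B.carrier ∧ P = D.plaque B a}

/-- The leaves of the germ universal cover. -/
def leaf (D : GermData n X Lt G) (a : D.Cover) : Set D.Cover :=
  @connectedComponent D.Cover D.leafTop a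

/-! ### The geometric groupoid structure -/

/-- `D.Acts g a b`: the element `g` of `*G` is defined on the class `a` and carries it to `b`; that
is, for some representatives the sequence `g α • s α` is convergent, with the limit of `a`, and it
represents `b`. -/
def Acts (D : GermData n X Lt G) (g : D.StarG) (a b : D.Cover) : Prop :=
  ∃ (γ : ℕ → G) (s s' : D.ConvSeq), (γ : D.StarG) = g ∧ D.cls s = a ∧ D.cls s' = b ∧
    (∀ α, s'.1 α = γ α • s.1 α) ∧ D.lim b = D.lim a

/-- The fundamental germ, with its geometric groupoid structure, is a group: it is closed under
multiplication, each of its elements is a map defined on the whole germ universal cover, and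
products act by composition. -/
structure IsGroup (D : GermData n X Lt G) : Prop where
  mul_mem : ∀ g ∈ D.germ, ∀ h ∈ D.germ, g * h ∈ D.germ
  total : ∀ g ∈ D.germ, ∀ a : D.Cover, ∃! b : D.Cover, D.Acts g a b
  comp : ∀ g ∈ D.germ, ∀ h ∈ D.germ, ∀ a b c : D.Cover,
    D.Acts h a b → D.Acts g b c → D.Acts (g * h) a c

/-- Tameness: any two classes with the same limit are related by an element of the germ. -/
def IsTame (D : GermData n X Lt G) : Prop :=
  ∀ a b : D.Cover, D.lim a = D.lim b → ∃ g ∈ D.germ, D.Acts g a b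

lemma one_mem_germ (D : GermData n X Lt G) : (1 : D.StarG) ∈ D.germ := by
  have h : (1 : D.StarG) ∈ D.dioph :=
    ⟨fun _ => 1, rfl, fun _ => by simpa using D.mem_T, by simp⟩
  exact ⟨1, h, 1, h, by simp⟩

/-- The fundamental germ as a subgroup of `*G`. -/
def group (D : GermData n X Lt G) (hD : D.IsGroup) : Subgroup D.StarG where
  carrier := D.germ
  mul_mem' := fun {g h} hg hh => hD.mul_mem g hg h hh
  one_mem' := D.one_mem_germ
  inv_mem' := by
    rintro _ ⟨g, hg, h, hh, rfl⟩
    exact ⟨h, hh, g, hg, by simp⟩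

lemma acts_one (D : GermData n X Lt G) (a : D.Cover) : D.Acts 1 a a := by
  obtain ⟨s, rfl⟩ := Quotient.exists_rep a
  exact ⟨fun _ => 1, s, s, rfl, rfl, rfl, fun α => by simp, rfl⟩

/-- The action of the fundamental germ on the germ universal cover, when it is a group. -/
noncomputable instance instMulAction (D : GermData n X Lt G) (hD : D.IsGroup) :
    MulAction (D.group hD) D.Cover where
  smul g a := (hD.total g.1 g.2 a).choose
  one_smul a :=
    (hD.total 1 D.one_mem_germ a).unique
      (hD.total (1 : D.group hD).1 (1 : D.group hD).2 a).choose_spec.1 (D.acts_one a)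
  mul_smul g h a :=
    (hD.total (g * h).1 (g * h).2 a).unique
      (hD.total (g * h).1 (g * h).2 a).choose_spec.1
      (hD.comp g.1 g.2 h.1 h.2 a _ _ (hD.total h.1 h.2 a).choose_spec.1
        (hD.total g.1 g.2 _).choose_spec.1)

lemma acts_smul (D : GermData n X Lt G) (hD : D.IsGroup) (g : D.group hD) (a : D.Cover) :
    D.Acts g.1 a (g • a) :=
  (hD.total g.1 g.2 a).choose_spec.1

lemma lim_smul (D : GermData n X Lt G) (hD : D.IsGroup) (g : D.group hD) (a : D.Cover) :
    D.lim (g • a) = D.lim a := by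
  obtain ⟨_, _, _, _, _, _, _, h⟩ := D.acts_smul hD g a
  exact h

/-! ### Topologies on the germ universal cover -/

/-- `τ` is a germ universal cover topology for which the fundamental germ acts by homeomorphisms.
It is obtained from a decomposition of the preimage of a transversal `T` into the disjoint
translates `g • i(T)` of a section `i` over `T` that meets each leaf at most once; the sections are
topologized through their identification with `T`, and `τ` is the associated product lamination
structure: locally it consists of copies of flow boxes, with the plaques of the germ universal
cover. -/
structure IsEquivariantTopology (D : GermData n X Lt G) (hD : D.IsGroup)
    (τ : TopologicalSpace D.Cover) : Prop where
  sheet : ∀ a : D.Cover, ∃ (B : D.lam.FlowBox) (s : X → D.Cover),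
    (∀ x ∈ B.carrier, D.lim (s x) = x) ∧
    a ∈ s '' B.carrier ∧
    (∀ x ∈ B.carrier, ∀ t ∈ B.T', x ∈ B.plaque t → s '' B.plaque t = D.plaque B (s x)) ∧
    (∀ V ⊆ B.carrier, IsOpen[τ] (s '' V) ↔ IsOpen V) ∧
    ∀ V : Set D.Cover, IsOpen[τ] V → IsOpen (s ⁻¹' V ∩ B.carrier)
  decomposition : ∃ (T : Set X) (i : T → D.Cover), D.lam.IsTransversal T ∧ D.lam.IsComplete T ∧
    (∀ t : T, D.lim (i t) = t) ∧
    (∀ t t' : T, i t' ∈ D.leaf (i t) → t' = t) ∧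
    Continuous[inferInstance, τ] i ∧
    (∀ (g g' : D.group hD) (t t' : T), g • i t = g' • i t' → g = g' ∧ t = t') ∧
    ∀ a : D.Cover, D.lim a ∈ T → ∃ (g : D.group hD) (t : T), g • i t = a
  smul_continuous : ∀ g : D.group hD, Continuous[τ, τ] fun a : D.Cover => g • a

/-! ### The quotient by a subgroup -/

section Quotient

variable (D : GermData n X Lt G) (hD : D.IsGroup) (C : Subgroup (D.group hD))

/-- The quotient of the germ universal cover by the subgroup `C`. -/
noncomputable def Quot : Type v := MulAction.orbitRel.Quotient C D.Cover

/-- The quotient map. -/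
noncomputable def toQuot (a : D.Cover) : D.Quot hD C := Quotient.mk (MulAction.orbitRel C D.Cover) a

/-- The projection of the quotient onto the lamination. -/
noncomputable def proj : D.Quot hD C → X :=
  Quotient.lift D.lim (by
    rintro a b ⟨c, rfl⟩
    exact D.lim_smul hD c.1 b)

/-- The quotient topology induced by a topology on the germ universal cover. -/
@[reducible] noncomputable def quotTop (σ : TopologicalSpace D.Cover) : TopologicalSpace (D.Quot hD C) :=
  σ.coinduced (D.toQuot hD C)

/-- The leaf topology of the quotient, induced by that of the germ universal cover. -/
@[reducible] noncomputable def quotLeafTop : TopologicalSpace (D.Quot hD C) :=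
  D.leafTop.coinduced (D.toQuot hD C)

/-- Lamination structures on the quotient, with the topology induced by `σ`, whose leaves are the
images of the leaves of the germ universal cover. -/
structure QuotLamination (σ : TopologicalSpace D.Cover) where
  lam : Lamination n (D.Quot hD C) (D.quotTop hD C σ)
  leafTopology_eq : lam.leafTopology = D.quotLeafTop hD C

/-- The topologies `σ` among which the covering topology is a maximal one:
* the quotient, with the induced topology, is a (possibly non Hausdorff) lamination in which the
  leaves over the dense leaf are dense, and which projects by a lamination map; no orbit of `C` is
  open in the preimage of a (complete open) transversal of the quotient that contains it;
* the identity map from `σ` to `τ` is open;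
* the fundamental germ acts by homeomorphisms for `σ`. -/
structure IsCandidate (τ σ : TopologicalSpace D.Cover) : Prop where
  lamination : ∃ 𝓜 : D.QuotLamination hD C σ,
    (∀ ξ : D.Quot hD C, D.proj hD C ξ ∈ D.lam.leaf (D.p D.xt) →
      @Dense _ (D.quotTop hD C σ) (𝓜.lam.leaf ξ)) ∧
    IsLaminationMap 𝓜.lam D.lam (D.proj hD C) ∧
    ∀ T : Set (D.Quot hD C), 𝓜.lam.IsTransversal T → 𝓜.lam.IsComplete T →
      ∀ a : D.Cover, D.toQuot hD C a ∈ T →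
        ¬ ∃ V : Set D.Cover, IsOpen[σ] V ∧
          V ∩ D.toQuot hD C ⁻¹' T = {b | ∃ c : C, b = c • a}
  id_open : ∀ V : Set D.Cover, IsOpen[σ] V → IsOpen[τ] V
  smul_continuous : ∀ g : D.group hD, Continuous[σ, σ] fun a : D.Cover => g • a

/-- Covering topologies: the maximal candidates, for the inclusion of families of open sets. -/
structure IsCoveringTopology (τ σ : TopologicalSpace D.Cover) : Prop where
  isCandidate : D.IsCandidate hD C τ σ
  maximal : ∀ σ' : TopologicalSpace D.Cover, D.IsCandidate hD C τ σ' →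
    (∀ V : Set D.Cover, IsOpen[σ] V → IsOpen[σ'] V) →
    ∀ V : Set D.Cover, IsOpen[σ'] V → IsOpen[σ] V

variable {D hD C}

/-- The automorphisms of the covering `proj`: lamination homeomorphisms of the quotient (they carry
leaves homeomorphically to leaves, and transversals to transversals) over the identity of the
lamination that are geometric, that is, covered by a homeomorphism `Φ` of the germ universal cover
which is equivariant with respect to an automorphism `f` of the group `C`, the fundamental germ of
the quotient. -/
structure IsAutomorphism {σ : TopologicalSpace D.Cover} (𝓜 : D.QuotLamination hD C σ)
    (F : Equiv.Perm (D.Quot hD C)) : Prop where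
  proj_eq : ∀ ξ, D.proj hD C (F ξ) = D.proj hD C ξ
  isHomeomorph : @IsHomeomorph _ _ (D.quotTop hD C σ) (D.quotTop hD C σ) F
  leaves : @IsHomeomorph _ _ 𝓜.lam.leafTopology 𝓜.lam.leafTopology F
  transversals : ∀ T : Set (D.Quot hD C), 𝓜.lam.IsTransversal (F '' T) ↔ 𝓜.lam.IsTransversal T
  geometric : ∃ (f : C ≃* C) (Φ : Equiv.Perm D.Cover), @IsHomeomorph _ _ σ σ Φ ∧
    (∀ a, D.toQuot hD C (Φ a) = F (D.toQuot hD C a)) ∧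
    ∀ (c : C) (a : D.Cover), Φ (c • a) = f c • Φ a

lemma isHomeomorph_symm {Y : Type v} {t : TopologicalSpace Y} {F : Equiv.Perm Y}
    (h : IsHomeomorph F) : IsHomeomorph (F⁻¹ : Equiv.Perm Y) := by
  have e : (F⁻¹ : Equiv.Perm Y) = ((h.homeomorph F).symm : Y → Y) := by
    funext y
    apply F.injective
    exact (F.apply_symm_apply y).trans ((h.homeomorph F).apply_symm_apply y).symm
  rw [e]
  exact (h.homeomorph F).symm.isHomeomorph

variable (D hD C) in
/-- The group of automorphisms of the covering `proj`. -/
def Aut {σ : TopologicalSpace D.Cover} (𝓜 : D.QuotLamination hD C σ) :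
    Subgroup (Equiv.Perm (D.Quot hD C)) where
  carrier := {F | IsAutomorphism 𝓜 F}
  one_mem' :=
    { proj_eq := fun _ => rfl
      isHomeomorph := @IsHomeomorph.id _ (D.quotTop hD C σ)
      leaves := @IsHomeomorph.id _ 𝓜.lam.leafTopology
      transversals := fun T => by simp
      geometric := ⟨MulEquiv.refl C, 1, @IsHomeomorph.id _ σ, fun _ => rfl, fun _ _ => rfl⟩ }
  mul_mem' := by
    rintro F F' h h'
    obtain ⟨f, Φ, hΦ, hF, hf⟩ := h.geometric
    obtain ⟨f', Φ', hΦ', hF', hf'⟩ := h'.geometric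
    refine ⟨fun ξ => (h.proj_eq _).trans (h'.proj_eq ξ), ?_, ?_, fun T => ?_, f'.trans f, Φ * Φ', ?_, ?_,
      ?_⟩
    · rw [Equiv.Perm.coe_mul]
      exact @IsHomeomorph.comp _ _ _ (D.quotTop hD C σ) (D.quotTop hD C σ) (D.quotTop hD C σ)
        _ _ h.isHomeomorph h'.isHomeomorph
    · rw [Equiv.Perm.coe_mul]
      exact @IsHomeomorph.comp _ _ _ 𝓜.lam.leafTopology 𝓜.lam.leafTopology 𝓜.lam.leafTopology
        _ _ h.leaves h'.leaves
    · rw [Equiv.Perm.coe_mul, image_comp, h.transversals, h'.transversals]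
    · rw [Equiv.Perm.coe_mul]
      exact @IsHomeomorph.comp _ _ _ σ σ σ _ _ hΦ hΦ'
    · intro a
      simp [hF, hF']
    · intro c a
      simp [hf, hf']
  inv_mem' := by
    rintro F h
    obtain ⟨f, Φ, hΦ, hF, hf⟩ := h.geometric
    refine ⟨fun ξ => ?_, ?_, ?_, fun T => ?_, f.symm, Φ⁻¹, ?_, fun a => ?_, fun c a => ?_⟩
    · have := h.proj_eq (F⁻¹ ξ)
      simpa using this.symm
    · exact @isHomeomorph_symm _ (D.quotTop hD C σ) _ h.isHomeomorph
    · exact @isHomeomorph_symm _ 𝓜.lam.leafTopology _ h.leaves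
    · rw [← h.transversals (_ '' T), ← image_comp, ← Equiv.Perm.coe_mul]
      simp
    · exact @isHomeomorph_symm _ σ _ hΦ
    · apply F.injective
      rw [← hF]
      simp
    · apply Φ.injective
      rw [hf]
      simp

end Quotient

end GermData

end GermLam

/-! A map which is a homeomorphism both for the topology of a lamination and for its leaf topology
preserves the maximal atlas, hence the transversals. The fundamental germ acts on the germ universal
cover by such maps, because the sheets of `τ` carry the plaques; so it acts on the quotient by
automorphisms of `P_C`, and the kernel of this action is `C` because the germ acts freely over a
transversal.

Conversely let `F` be an automorphism. By tameness `F` agrees at one point of a dense leaf with some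
element of the germ. As `P_C` is leafwise locally injective and the quotient is Hausdorff, two
lifts of `P_C` which agree at a point of a leaf agree on that leaf, and by density they are equal.
Tameness also shows that the fibres of the open map `P_C` are exactly the orbits. -/

namespace GermLam

section Topology

variable {X Y Z : Type*} [TopologicalSpace X] [TopologicalSpace Y] [TopologicalSpace Z]

theorem exists_joinedIn_lift {f : Y → X} {s P : Set X} (hf : IsCoveringMapOn f s) (hP : P ⊆ s)
    {x y : X} (h : JoinedIn P x y) {e : Y} (he : f e = x) :
    ∃ e', f e' = y ∧ JoinedIn (f ⁻¹' P) e e' := by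
  obtain ⟨γ, hγ⟩ := h
  have he' : e ∈ f ⁻¹' s := mem_preimage.2 (he ▸ hP (γ.source ▸ hγ 0))
  obtain ⟨Γ, hΓ, hΓ0⟩ := hf.isCoveringMap_restrictPreimage.exists_path_lifts
    ⟨fun r => (⟨γ r, hP (hγ r)⟩ : s), γ.continuous.subtype_mk _⟩ ⟨e, he'⟩
    (Subtype.ext (γ.source.trans he.symm))
  have hlift (r) : f (Γ r) = γ r := congrArg Subtype.val (congrFun hΓ r)
  exact ⟨Γ 1, (hlift 1).trans γ.target,
    ⟨⟨fun r => (Γ r).1, continuous_subtype_val.comp Γ.continuous⟩, congrArg Subtype.val hΓ0, rfl⟩,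
    fun r => mem_preimage.2 ((hlift r).symm ▸ hγ r)⟩

theorem isHomeomorph_quotientLift {s : Setoid Y} {f : Y → Z} (hf : IsQuotientMap f)
    (h : ∀ a b, s a b ↔ f a = f b) :
    IsHomeomorph (Quotient.lift f fun a b => (h a b).1 : Quotient s → Z) := by
  refine isHomeomorph_iff_isQuotientMap_injective.2 ⟨?_, ?_⟩
  · exact IsQuotientMap.of_comp continuous_quotient_mk' (hf.continuous.quotient_lift _) hf
  · rintro ⟨a⟩ ⟨b⟩ hab
    exact Quotient.sound ((h a b).2 hab)

end Topology

namespace Lamination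

variable {n : ℕ} {X : Type*} {top : TopologicalSpace X} {𝓛 : Lamination n X top}

namespace FlowBox

theorem mem_carrier_iff {B : 𝓛.FlowBox} {x : X} :
    x ∈ B.carrier ↔ x ∈ B.φ.source ∧ B.φ x ∈ Metric.ball B.center B.radius ×ˢ B.T' := by
  rw [carrier, B.φ.symm_image_eq_source_inter_preimage B.subset_target]
  rfl

theorem plaque_subset_carrier (B : 𝓛.FlowBox) {t : 𝓛.S} (ht : t ∈ B.T') :
    B.plaque t ⊆ B.carrier :=
  image_mono (prod_mono_right (singleton_subset_iff.2 ht))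

theorem mem_plaque_iff {B : 𝓛.FlowBox} {t : 𝓛.S} (ht : t ∈ B.T') {x : X} :
    x ∈ B.plaque t ↔ x ∈ B.carrier ∧ (B.φ x).2 = t := by
  have hsub : Metric.ball B.center B.radius ×ˢ {t} ⊆ B.φ.target :=
    (prod_mono_right (singleton_subset_iff.2 ht)).trans B.subset_target
  rw [mem_carrier_iff, plaque, B.φ.symm_image_eq_source_inter_preimage hsub]
  constructor
  · rintro ⟨hx, hq, rfl⟩
    exact ⟨⟨hx, hq, ht⟩, rfl⟩
  · rintro ⟨⟨hx, hq, -⟩, rfl⟩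
    exact ⟨hx, hq, rfl⟩

theorem snd_mem {B : 𝓛.FlowBox} {x : X} (hx : x ∈ B.carrier) : (B.φ x).2 ∈ B.T' :=
  (mem_carrier_iff.1 hx).2.2

theorem mem_plaque_snd {B : 𝓛.FlowBox} {x : X} (hx : x ∈ B.carrier) :
    x ∈ B.plaque (B.φ x).2 :=
  (mem_plaque_iff (snd_mem hx)).2 ⟨hx, rfl⟩

theorem eq_of_mem_plaque {B : 𝓛.FlowBox} {t t' : 𝓛.S} (ht : t ∈ B.T') (ht' : t' ∈ B.T') {x : X}
    (h : x ∈ B.plaque t) (h' : x ∈ B.plaque t') : t = t' :=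
  ((mem_plaque_iff ht).1 h).2.symm.trans ((mem_plaque_iff ht').1 h').2

theorem isOpen_plaque (B : 𝓛.FlowBox) {t : 𝓛.S} (ht : t ∈ B.T') :
    IsOpen[𝓛.leafTopology] (B.plaque t) :=
  TopologicalSpace.isOpen_generateFrom_of_mem ⟨B, t, ht, rfl⟩

theorem exists_subset_of_mem_atlas {φ : OpenPartialHomeomorph X (Horiz n × 𝓛.S)}
    (hφ : φ ∈ 𝓛.atlas) {x : X} (hx : x ∈ φ.source) {V : Set X} (hV : IsOpen V) (hxV : x ∈ V) :
    ∃ B : 𝓛.FlowBox, B.φ = φ ∧ x ∈ B.carrier ∧ B.carrier ⊆ V := by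
  have hW : φ.target ∩ φ.symm ⁻¹' V ∈ 𝓝 ((φ x).1, (φ x).2) :=
    (φ.isOpen_inter_preimage_symm hV).mem_nhds
      ⟨φ.map_source hx, by rwa [mem_preimage, φ.left_inv hx]⟩
  rw [nhds_prod_eq] at hW
  obtain ⟨⟨r, T'⟩, ⟨hr, hT, hT'⟩, hsub⟩ :=
    (Metric.nhds_basis_ball.prod (nhds_basis_opens (φ x).2)).mem_iff.1 hW
  refine ⟨⟨φ, hφ, (φ x).1, r, hr, T', hT', fun z hz => (hsub hz).1⟩, rfl, ?_, ?_⟩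
  · exact mem_carrier_iff.2 ⟨hx, Metric.mem_ball_self hr, hT⟩
  · exact image_subset_iff.2 fun z hz => (hsub hz).2

theorem exists_subset {x : X} {V : Set X} (hV : IsOpen V) (hxV : x ∈ V) :
    ∃ B : 𝓛.FlowBox, x ∈ B.carrier ∧ B.carrier ⊆ V := by
  obtain ⟨φ, hφ, hx⟩ := 𝓛.cover x
  obtain ⟨B, -, hB⟩ := exists_subset_of_mem_atlas hφ hx hV hxV
  exact ⟨B, hB⟩

theorem exists_plaque_subset_plaque {B B' : 𝓛.FlowBox} (h : B.carrier ⊆ B'.carrier) {t : 𝓛.S}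
    (ht : t ∈ B.T') : ∃ t' ∈ B'.T', B.plaque t ⊆ B'.plaque t' := by
  have hB' {q} (hq : q ∈ Metric.ball B.center B.radius) : B.φ.symm (q, t) ∈ B'.carrier :=
    h ⟨(q, t), ⟨hq, ht⟩, rfl⟩
  obtain ⟨O', t', -, hO'⟩ := 𝓛.compatible B.φ B.mem_atlas B'.φ B'.mem_atlas _ t
    Metric.isOpen_ball (convex_ball B.center B.radius).isPreconnected (by
      rintro ⟨q, s⟩ ⟨hq, rfl : s = t⟩
      rw [OpenPartialHomeomorph.trans_source]
      exact ⟨B.subset_target ⟨hq, ht⟩, (mem_carrier_iff.1 (hB' hq)).1⟩)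
  have hsnd {q} (hq : q ∈ Metric.ball B.center B.radius) : (B'.φ (B.φ.symm (q, t))).2 = t' :=
    (hO'.subset (mem_image_of_mem _ (mk_mem_prod hq rfl))).2
  have ht' : t' ∈ B'.T' :=
    hsnd (Metric.mem_ball_self B.radius_pos) ▸ snd_mem (hB' (Metric.mem_ball_self B.radius_pos))
  refine ⟨t', ht', ?_⟩
  rintro _ ⟨⟨q, s⟩, ⟨hq, rfl : s = t⟩, rfl⟩
  exact (mem_plaque_iff ht').2 ⟨hB' hq, hsnd hq⟩

end FlowBox

theorem leafTopology_le (𝓛 : Lamination n X top) : 𝓛.leafTopology ≤ top := by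
  intro V hV
  refine (@isOpen_iff_forall_mem_open _ 𝓛.leafTopology _).2 fun x hx => ?_
  obtain ⟨B, hB, hBV⟩ := FlowBox.exists_subset (𝓛 := 𝓛) hV hx
  exact ⟨_, (B.plaque_subset_carrier (FlowBox.snd_mem hB)).trans hBV,
    B.isOpen_plaque (FlowBox.snd_mem hB), FlowBox.mem_plaque_snd hB⟩

/-- A chart of the topology `top` is a leaf chart if its horizontal slices are local
homeomorphisms onto open subsets of the leaf topology. The charts of the atlas are leaf charts, and
unlike membership in the atlas this property mentions only the two topologies, so that it is
visibly invariant under maps which are homeomorphisms for both of them. -/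
def IsLeafChart (𝓛 : Lamination n X top) (φ : OpenPartialHomeomorph X (Horiz n × 𝓛.S)) : Prop :=
  ∀ x ∈ φ.source,
    @nhds X 𝓛.leafTopology x = map (fun q => φ.symm (q, (φ x).2)) (𝓝 (φ x).1)

theorem isLeafChart_of_mem_atlas {φ : OpenPartialHomeomorph X (Horiz n × 𝓛.S)}
    (hφ : φ ∈ 𝓛.atlas) : 𝓛.IsLeafChart φ := by
  intro x hx
  refine le_antisymm (fun V hV => ?_) ?_
  · obtain ⟨O, hOV, hO, hxO⟩ := mem_nhds_iff.1 hV
    obtain ⟨B, rfl, hxB, hB⟩ := FlowBox.exists_subset_of_mem_atlas hφ hx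
      (φ.isOpen_inter_preimage (hO.preimage continuous_fst)) ⟨hx, hxO⟩
    have ht := FlowBox.snd_mem hxB
    refine mem_of_superset (@IsOpen.mem_nhds _ 𝓛.leafTopology _ _ (B.isOpen_plaque ht)
      (FlowBox.mem_plaque_snd hxB)) fun y hy => ?_
    obtain ⟨hyB, hyt⟩ := (FlowBox.mem_plaque_iff ht).1 hy
    obtain ⟨hyφ, hyO⟩ := hB hyB
    have hyV : B.φ.symm ((B.φ y).1, (B.φ x).2) ∈ V := hOV hyO
    rwa [← hyt, Prod.mk.eta, B.φ.left_inv hyφ] at hyV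
  · refine TopologicalSpace.tendsto_nhds_generateFrom_iff.2 ?_
    rintro _ ⟨B', t', ht', rfl⟩ hxB'
    obtain ⟨B, rfl, hxB, hB⟩ := FlowBox.exists_subset_of_mem_atlas hφ hx
      (GermData.flowBox_isOpen B') (B'.plaque_subset_carrier ht' hxB')
    obtain ⟨t, ht, hsub⟩ := FlowBox.exists_plaque_subset_plaque hB (FlowBox.snd_mem hxB)
    obtain rfl := FlowBox.eq_of_mem_plaque ht ht' (hsub (FlowBox.mem_plaque_snd hxB)) hxB'
    filter_upwards [Metric.isOpen_ball.mem_nhds (FlowBox.mem_carrier_iff.1 hxB).2.1] with q hq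
    exact hsub (mem_image_of_mem _ (mk_mem_prod hq rfl))

namespace IsLeafChart

variable {φ ψ : OpenPartialHomeomorph X (Horiz n × 𝓛.S)}

theorem nhds_symm (hφ : 𝓛.IsLeafChart φ) {q : Horiz n} {t : 𝓛.S} (h : (q, t) ∈ φ.target) :
    @nhds X 𝓛.leafTopology (φ.symm (q, t)) = map (fun q' => φ.symm (q', t)) (𝓝 q) := by
  rw [hφ _ (φ.map_target h), φ.right_inv h]

theorem eventually_apply_symm {x : X} (hx : x ∈ φ.source) :
    ∀ᶠ q in 𝓝 (φ x).1, φ (φ.symm (q, (φ x).2)) = (q, (φ x).2) := by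
  filter_upwards [(Continuous.prodMk_left (φ x).2).continuousAt.preimage_mem_nhds
    (φ.open_target.mem_nhds (φ.map_source hx))] with q hq
  exact φ.right_inv hq

theorem eventually_snd_eq (hφ : 𝓛.IsLeafChart φ) {x : X} (hx : x ∈ φ.source) :
    ∀ᶠ y in @nhds X 𝓛.leafTopology x, (φ y).2 = (φ x).2 := by
  rw [hφ x hx, eventually_map]
  exact (eventually_apply_symm hx).mono fun q hq => by rw [hq]

theorem map_fst_nhds (hφ : 𝓛.IsLeafChart φ) {x : X} (hx : x ∈ φ.source) :
    map (fun y => (φ y).1) (@nhds X 𝓛.leafTopology x) = 𝓝 (φ x).1 := by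
  rw [hφ x hx, map_map]
  exact (map_congr ((eventually_apply_symm hx).mono fun q hq => congrArg Prod.fst hq)).trans map_id

theorem cardCompatible (hφ : 𝓛.IsLeafChart φ) (hψ : 𝓛.IsLeafChart ψ) : CardCompatible φ ψ := by
  intro O t hO hO' hsub
  have hnhds {q} (hq : q ∈ O) :
      map (fun q' => φ.symm (q', t)) (𝓝 q) = @nhds X 𝓛.leafTopology (φ.symm (q, t)) :=
    (hφ.nhds_symm (hsub (mk_mem_prod hq rfl)).1).symm
  have hsource {q} (hq : q ∈ O) : φ.symm (q, t) ∈ ψ.source := (hsub (mk_mem_prod hq rfl)).2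
  obtain ⟨t', ht'⟩ : ∃ t', ∀ q ∈ O, (ψ (φ.symm (q, t))).2 = t' := by
    rcases O.eq_empty_or_nonempty with rfl | ⟨q₀, hq₀⟩
    · exact ⟨t, fun q hq => hq.elim⟩
    · refine ⟨_, fun q hq => hO'.induction₂
        (fun q q' => (ψ (φ.symm (q, t))).2 = (ψ (φ.symm (q', t))).2) (fun p hp => ?_)
        (fun _ _ _ _ _ _ => Eq.trans) (fun _ _ _ _ => Eq.symm) hq hq₀⟩
      have h := hψ.eventually_snd_eq (hsource hp)
      rw [← hnhds hp, eventually_map] at h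
      exact (h.mono fun _ => Eq.symm).filter_mono nhdsWithin_le_nhds
  refine ⟨(fun q => (ψ (φ.symm (q, t))).1) '' O, t', isOpen_iff_mem_nhds.2 ?_, ?_⟩
  · rintro _ ⟨q, hq, rfl⟩
    dsimp only
    rw [← hψ.map_fst_nhds (hsource hq), ← hnhds hq, map_map]
    exact image_mem_map (hO.mem_nhds hq)
  · rw [prod_singleton, prod_singleton, image_image, image_image]
    exact image_congr fun q hq => Prod.ext rfl (ht' q hq)

theorem symm_trans (hφ : 𝓛.IsLeafChart φ) (H : X ≃ₜ X)
    (hH : @IsHomeomorph X X 𝓛.leafTopology 𝓛.leafTopology H) :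
    𝓛.IsLeafChart (H.symm.toOpenPartialHomeomorph.trans φ) := by
  intro x hx
  have hx' : H.symm x ∈ φ.source := by simpa using hx
  have hmap : map H (@nhds X 𝓛.leafTopology (H.symm x)) = @nhds X 𝓛.leafTopology (H (H.symm x)) :=
    @Homeomorph.map_nhds_eq _ _ 𝓛.leafTopology 𝓛.leafTopology
      (@IsHomeomorph.homeomorph _ _ 𝓛.leafTopology 𝓛.leafTopology H hH) (H.symm x)
  rw [H.apply_symm_apply, hφ _ hx', map_map] at hmap
  exact hmap.symm

end IsLeafChart

theorem symm_trans_mem_atlas {φ : OpenPartialHomeomorph X (Horiz n × 𝓛.S)} (hφ : φ ∈ 𝓛.atlas)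
    (H : X ≃ₜ X) (hH : @IsHomeomorph X X 𝓛.leafTopology 𝓛.leafTopology H) :
    H.symm.toOpenPartialHomeomorph.trans φ ∈ 𝓛.atlas := by
  have h := (isLeafChart_of_mem_atlas hφ).symm_trans H hH
  exact 𝓛.maximal _ fun ψ hψ =>
    ⟨h.cardCompatible (isLeafChart_of_mem_atlas hψ),
      (isLeafChart_of_mem_atlas hψ).cardCompatible h⟩

theorem IsTransversal.image {T : Set X} (hT : 𝓛.IsTransversal T) (H : X ≃ₜ X)
    (hH : @IsHomeomorph X X 𝓛.leafTopology 𝓛.leafTopology H) : 𝓛.IsTransversal (H '' T) := by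
  obtain ⟨φ, hφ, a, T', hT', hsub, rfl⟩ := hT
  refine ⟨_, symm_trans_mem_atlas hφ H hH, a, T', hT', ?_, (image_comp H φ.symm _).symm⟩
  simpa using hsub

theorem isTransversal_image_iff {T : Set X} (H : X ≃ₜ X)
    (hH : @IsHomeomorph X X 𝓛.leafTopology 𝓛.leafTopology H) :
    𝓛.IsTransversal (H '' T) ↔ 𝓛.IsTransversal T := by
  refine ⟨fun h => ?_, fun h => h.image H hH⟩
  have hsymm : @IsHomeomorph X X 𝓛.leafTopology 𝓛.leafTopology H.symm :=
    @GermData.isHomeomorph_symm X 𝓛.leafTopology H.toEquiv hH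
  simpa only [← image_comp, H.symm_comp_self, image_id] using h.image H.symm hsymm

theorem mem_leaf_self (𝓛 : Lamination n X top) (x : X) : x ∈ 𝓛.leaf x :=
  @mem_connectedComponent X 𝓛.leafTopology x

theorem leaf_eq_of_mem {x y : X} (h : y ∈ 𝓛.leaf x) : 𝓛.leaf x = 𝓛.leaf y :=
  @connectedComponent_eq X 𝓛.leafTopology _ _ h

theorem FlowBox.isPathConnected_plaque (B : 𝓛.FlowBox) {t : 𝓛.S} (ht : t ∈ B.T') :
    @IsPathConnected X 𝓛.leafTopology (B.plaque t) := by
  have hball := (convex_ball B.center B.radius).isPathConnected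
    (Metric.nonempty_ball.2 B.radius_pos)
  rw [plaque, prod_singleton, image_image]
  refine @IsPathConnected.image' _ _ _ 𝓛.leafTopology _ hball _
    (@continuousOn_of_forall_continuousAt _ _ _ 𝓛.leafTopology _ _ fun q hq => ?_)
  exact ((isLeafChart_of_mem_atlas B.mem_atlas).nhds_symm (B.subset_target ⟨hq, ht⟩)).ge

theorem FlowBox.plaque_subset_leaf (B : 𝓛.FlowBox) {t : 𝓛.S} (ht : t ∈ B.T') {x : X}
    (hx : x ∈ B.plaque t) : B.plaque t ⊆ 𝓛.leaf x :=
  let _ : TopologicalSpace X := 𝓛.leafTopology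
  (B.isPathConnected_plaque ht).isConnected.isPreconnected.subset_connectedComponent hx

theorem leaf_subset_of_forall_plaque_subset {P : Set X}
    (hP : ∀ (B : 𝓛.FlowBox), ∀ t ∈ B.T', (B.plaque t ∩ P).Nonempty → B.plaque t ⊆ P) {x : X}
    (hx : x ∈ P) : 𝓛.leaf x ⊆ P := by
  have hplaque (y : X) : ∃ Q, IsOpen[𝓛.leafTopology] Q ∧ y ∈ Q ∧ ((Q ∩ P).Nonempty → Q ⊆ P) := by
    obtain ⟨B, hB, -⟩ := FlowBox.exists_subset (𝓛 := 𝓛) isOpen_univ (mem_univ y)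
    exact ⟨_, B.isOpen_plaque (FlowBox.snd_mem hB), FlowBox.mem_plaque_snd hB,
      hP B _ (FlowBox.snd_mem hB)⟩
  let _ : TopologicalSpace X := 𝓛.leafTopology
  have hopen : IsOpen P := isOpen_iff_forall_mem_open.2 fun y hy => by
    obtain ⟨Q, hQ, hyQ, hQP⟩ := hplaque y
    exact ⟨Q, hQP ⟨y, hyQ, hy⟩, hQ, hyQ⟩
  have hclosed : IsOpen Pᶜ := isOpen_iff_forall_mem_open.2 fun y hy => by
    obtain ⟨Q, hQ, hyQ, hQP⟩ := hplaque y
    exact ⟨Q, fun z hz hzP => hy (hQP ⟨z, hz, hzP⟩ hyQ), hQ, hyQ⟩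
  exact IsClopen.connectedComponent_subset ⟨isOpen_compl_iff.1 hclosed, hopen⟩ hx

theorem t2Space_leafTopology (𝓛 : Lamination n X top) [T2Space X] :
    @T2Space X 𝓛.leafTopology :=
  @T2Space.of_injective_continuous X X 𝓛.leafTopology top _ id Function.injective_id
    (continuous_id_of_le 𝓛.leafTopology_le)

theorem eq_of_comp_eq_of_dense_leaf [T2Space X] {Y Z : Type*} {topY : TopologicalSpace Y}
    {𝓜 : Lamination n Y topY} {f : X → Z} (hf : @IsLocallyInjective X Z 𝓛.leafTopology f)
    {F F' : Y → X} (hF : Continuous F) (hF' : Continuous F')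
    (hFl : Continuous[𝓜.leafTopology, 𝓛.leafTopology] F)
    (hFl' : Continuous[𝓜.leafTopology, 𝓛.leafTopology] F')
    (hcomp : f ∘ F = f ∘ F') {y : Y} (hy : Dense (𝓜.leaf y)) (h : F y = F' y) : F = F' := by
  refine Continuous.ext_on hy hF hF' ?_
  let _ : TopologicalSpace X := 𝓛.leafTopology
  let _ : TopologicalSpace Y := 𝓜.leafTopology
  have := 𝓛.t2Space_leafTopology
  exact (T2Space.isSeparatedMap f).eqOn_of_comp_eqOn hf isPreconnected_connectedComponent
    hFl.continuousOn hFl'.continuousOn (hcomp ▸ eqOn_refl _ _) mem_connectedComponent h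

end Lamination

namespace GermData

open Lamination

section Plaque

variable {n : ℕ} {X : Type*} [TopologicalSpace X] {Lt : Type*} [TopologicalSpace Lt]
  {G : Type*} [Group G] [MulAction G Lt] {D : GermData n X Lt G} {B B' : D.lam.FlowBox}

theorem CommonLift.mono (hB : B.carrier ⊆ B'.carrier) {y z : Lt} (h : D.CommonLift B y z) :
    D.CommonLift B' y z := by
  obtain ⟨t, ht, hyz⟩ := h
  obtain ⟨t', ht', hsub⟩ := FlowBox.exists_plaque_subset_plaque hB ht
  exact ⟨t', ht', hyz.mono (preimage_mono hsub)⟩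

theorem exists_commonLift {z : Lt} {t : D.lam.S} (ht : t ∈ B.T') (hz : D.p z ∈ B.plaque t)
    {y : X} (hy : y ∈ B.plaque t) : ∃ z', D.p z' = y ∧ D.CommonLift B z z' := by
  have hleaf : B.plaque t ⊆ D.lam.leaf (D.p D.xt) := by
    rw [leaf_eq_of_mem (D.range_eq ▸ mem_range_self z : D.p z ∈ D.lam.leaf (D.p D.xt))]
    exact B.plaque_subset_leaf ht hz
  obtain ⟨z', hz', hzz'⟩ := @exists_joinedIn_lift _ _ D.lam.leafTopology _ _ _ _ D.covering hleaf
    _ _ (@IsPathConnected.joinedIn _ D.lam.leafTopology _ (B.isPathConnected_plaque ht) _ hz _ hy)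
    _ rfl
  exact ⟨z', hz', t, ht, hzz'⟩

variable [T2Space X] {a b c : D.Cover}

theorem tendsto_lim (s : D.ConvSeq) :
    Tendsto (fun α => D.p (s.1 α)) atTop (𝓝 (D.lim (D.cls s))) :=
  s.2.choose_spec

theorem lim_cls_eq {s : D.ConvSeq} {x : X} (h : Tendsto (fun α => D.p (s.1 α)) atTop (𝓝 x)) :
    D.lim (D.cls s) = x :=
  tendsto_nhds_unique (tendsto_lim s) h

theorem exists_lim_mem_leaf (D : GermData n X Lt G) :
    ∃ a : D.Cover, D.lim a ∈ D.lam.leaf (D.p D.xt) := by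
  have h : D.lim (D.cls ⟨fun _ => D.xt, _, tendsto_const_nhds⟩) = D.p D.xt :=
    lim_cls_eq tendsto_const_nhds
  exact ⟨_, mem_of_eq_of_mem h (D.lam.mem_leaf_self _)⟩

theorem eventually_commonLift {s s' : D.ConvSeq} (h : D.cls s = D.cls s')
    (hB : D.lim (D.cls s) ∈ B.carrier) :
    ∀ᶠ α in (D.U : Filter ℕ), D.CommonLift B (s.1 α) (s'.1 α) := by
  obtain ⟨x, hx, -, hs⟩ : D.Asymptotic s s' := Quotient.exact h
  exact hs B (lim_cls_eq hx ▸ hB)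

theorem mem_plaque_self (h : D.lim a ∈ B.carrier) : a ∈ D.plaque B a := by
  obtain ⟨s, rfl⟩ := Quotient.exists_rep a
  exact ⟨⟨_, FlowBox.snd_mem h, FlowBox.mem_plaque_snd h, FlowBox.mem_plaque_snd h⟩,
    s, s, rfl, rfl, eventually_commonLift rfl h⟩

theorem plaque_trans (hb : b ∈ D.plaque B a) (hc : c ∈ D.plaque B b) : c ∈ D.plaque B a := by
  obtain ⟨⟨t, ht, hat, hbt⟩, s, s', rfl, rfl, hs⟩ := hb
  obtain ⟨⟨t', ht', hbt', hct'⟩, r, r', hr, rfl, hr'⟩ := hc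
  obtain rfl := FlowBox.eq_of_mem_plaque ht ht' hbt hbt'
  refine ⟨⟨t, ht, hat, hct'⟩, s, r', rfl, rfl, ?_⟩
  filter_upwards [hs, eventually_commonLift hr.symm (B.plaque_subset_carrier ht hbt), hr']
    with α h₁ h₂ h₃
  exact (h₁.trans h₂).trans h₃

theorem plaque_mono (hB : B.carrier ⊆ B'.carrier) (a : D.Cover) :
    D.plaque B a ⊆ D.plaque B' a := by
  rintro b ⟨⟨t, ht, ha, hb⟩, s, s', hs, hs', h⟩
  obtain ⟨t', ht', hsub⟩ := FlowBox.exists_plaque_subset_plaque hB ht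
  exact ⟨⟨t', ht', hsub ha, hsub hb⟩, s, s', hs, hs', h.mono fun _ => CommonLift.mono hB⟩

theorem isOpen_plaque (ha : D.lim a ∈ B.carrier) : IsOpen[D.leafTop] (D.plaque B a) :=
  TopologicalSpace.isOpen_generateFrom_of_mem ⟨B, a, ha, rfl⟩

theorem lim_mem_carrier (hb : b ∈ D.plaque B a) : D.lim b ∈ B.carrier := by
  obtain ⟨⟨t, ht, -, hbt⟩, -⟩ := hb
  exact B.plaque_subset_carrier ht hbt

/- The terms of a sequence representing `a` are moved, along lifts of their plaques, until their
horizontal coordinate is that of `y`; their transverse coordinate, which converges to that of `y`,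
does not change. -/
theorem exists_mem_plaque_lim_eq {t : D.lam.S} (ht : t ∈ B.T') (ha : D.lim a ∈ B.plaque t) {y : X}
    (hy : y ∈ B.plaque t) : ∃ b ∈ D.plaque B a, D.lim b = y := by
  obtain ⟨s, rfl⟩ := Quotient.exists_rep a
  have hs : Tendsto (fun α => D.p (s.1 α)) atTop (𝓝 (D.lim (D.cls s))) := tendsto_lim s
  obtain ⟨haB, hat : (B.φ (D.lim (D.cls s))).2 = t⟩ := (FlowBox.mem_plaque_iff ht).1 ha
  obtain ⟨hyB, hyt⟩ := (FlowBox.mem_plaque_iff ht).1 hy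
  have hyφ := (FlowBox.mem_carrier_iff.1 hyB).1
  let y' (α : ℕ) : X := B.φ.symm ((B.φ y).1, (B.φ (D.p (s.1 α))).2)
  have hsB : ∀ᶠ α in atTop, D.p (s.1 α) ∈ B.carrier := hs ((flowBox_isOpen B).mem_nhds haB)
  have hy' : Tendsto y' atTop (𝓝 y) := by
    have hφs : Tendsto (fun α => B.φ (D.p (s.1 α))) atTop (𝓝 (B.φ (D.lim (D.cls s)))) :=
      (B.φ.continuousAt (FlowBox.mem_carrier_iff.1 haB).1).tendsto.comp hs
    have hsnd : Tendsto (fun α => ((B.φ y).1, (B.φ (D.p (s.1 α))).2)) atTop (𝓝 (B.φ y)) := by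
      have h := (tendsto_const_nhds (x := (B.φ y).1)).prodMk_nhds
        ((continuous_snd.tendsto _).comp hφs)
      rwa [hat, ← hyt] at h
    exact (B.φ.tendsto_symm hyφ).comp hsnd
  have hlift (α) : ∃ z, D.p (s.1 α) ∈ B.carrier → D.p z = y' α ∧ D.CommonLift B (s.1 α) z := by
    by_cases hα : D.p (s.1 α) ∈ B.carrier
    · obtain ⟨z, hz⟩ := exists_commonLift (FlowBox.snd_mem hα) (FlowBox.mem_plaque_snd hα)
        (mem_image_of_mem _ (mk_mem_prod (FlowBox.mem_carrier_iff.1 hyB).2.1 rfl))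
      exact ⟨z, fun _ => hz⟩
    · exact ⟨s.1 α, fun h => absurd h hα⟩
  choose z hz using hlift
  have hzy : Tendsto (fun α => D.p (z α)) atTop (𝓝 y) :=
    hy'.congr' (hsB.mono fun α hα => (hz α hα).1.symm)
  have hlim : D.lim (D.cls ⟨z, y, hzy⟩) = y := lim_cls_eq hzy
  refine ⟨_, ⟨⟨t, ht, ha, hlim.symm ▸ hy⟩, s, _, rfl, rfl, ?_⟩, hlim⟩
  exact (hsB.filter_mono D.U_le).mono fun α hα => (hz α hα).2

theorem leaf_lim_subset_range (a : D.Cover) : D.lam.leaf (D.lim a) ⊆ range D.lim := by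
  refine leaf_subset_of_forall_plaque_subset ?_ (mem_range_self a)
  rintro B t ht ⟨_, hb, b, rfl⟩ y hy
  obtain ⟨c, -, hc⟩ := exists_mem_plaque_lim_eq ht hb hy
  exact ⟨c, hc⟩

end Plaque

section Sheet

variable {n : ℕ} {X : Type*} [TopologicalSpace X] [T2Space X] {Lt : Type*} [TopologicalSpace Lt]
  {G : Type*} [Group G] [MulAction G Lt] {D : GermData n X Lt G} {hD : D.IsGroup}
  {τ : TopologicalSpace D.Cover} {B B' : D.lam.FlowBox} {s s' : X → D.Cover} {a b : D.Cover}

/-- A sheet of `τ` over the flow box `B`: a section `s` of the limit which maps `B` onto a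
`τ`-open set, continuously, and the plaques of `B` onto plaques of the germ universal cover. Only
the values of `s` on `B` matter. -/
structure IsSheet (τ : TopologicalSpace D.Cover) (B : D.lam.FlowBox) (s : X → D.Cover) :
    Prop where
  lim_apply : ∀ x ∈ B.carrier, D.lim (s x) = x
  image_plaque : ∀ x ∈ B.carrier, s '' B.plaque (B.φ x).2 = D.plaque B (s x)
  isOpen_image : IsOpen[τ] (s '' B.carrier)
  isOpen_preimage : ∀ V, IsOpen[τ] V → IsOpen (s ⁻¹' V ∩ B.carrier)

theorem IsSheet.apply_lim_of_mem_plaque (hs : IsSheet τ B s) (ha : s (D.lim a) = a)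
    (hb : b ∈ D.plaque B a) : s (D.lim b) = b := by
  obtain ⟨⟨t, ht, hat, -⟩, -⟩ := id hb
  have haB := B.plaque_subset_carrier ht hat
  rw [← ha, ← hs.image_plaque _ haB] at hb
  obtain ⟨y, hy, rfl⟩ := hb
  rw [hs.lim_apply y (B.plaque_subset_carrier (FlowBox.snd_mem haB) hy)]

theorem IsSheet.injOn_lim_plaque (hs : IsSheet τ B s) (ha : s (D.lim a) = a) :
    InjOn D.lim (D.plaque B a) := fun b hb c hc h => by
  rw [← hs.apply_lim_of_mem_plaque ha hb, h, hs.apply_lim_of_mem_plaque ha hc]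

theorem IsSheet.isOpen_setOf_apply_eq (hs : IsSheet τ B s) (hs' : IsSheet τ B' s')
    {f : D.Cover → D.Cover} (hf : Continuous[τ, τ] f) (hlim : ∀ a, D.lim (f a) = D.lim a) :
    IsOpen {x | x ∈ B.carrier ∧ x ∈ B'.carrier ∧ f (s x) = s' x} := by
  convert hs.isOpen_preimage _ (@Continuous.isOpen_preimage _ _ τ τ f hf _ hs'.isOpen_image) using 1
  ext x
  constructor
  · rintro ⟨hx, hx', h⟩
    exact ⟨⟨x, hx', h.symm⟩, hx⟩
  · rintro ⟨⟨y, hy, h⟩, hx⟩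
    obtain rfl : y = x := by rw [← hs'.lim_apply y hy, h, hlim, hs.lim_apply x hx]
    exact ⟨hx, hy, h.symm⟩

namespace IsEquivariantTopology

theorem exists_isSheet (hτ : D.IsEquivariantTopology hD τ) (a : D.Cover) :
    ∃ (B : D.lam.FlowBox) (s : X → D.Cover),
      IsSheet τ B s ∧ D.lim a ∈ B.carrier ∧ s (D.lim a) = a := by
  obtain ⟨B, s, hlim, ⟨x, hx, rfl⟩, hplaque, himage, hpreimage⟩ := hτ.sheet a
  refine ⟨B, s, ⟨hlim, fun y hy => ?_, ?_, hpreimage⟩, ?_⟩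
  · exact hplaque y hy _ (FlowBox.snd_mem hy) (FlowBox.mem_plaque_snd hy)
  · exact (himage _ Subset.rfl).2 (flowBox_isOpen B)
  · rw [hlim x hx]
    exact ⟨hx, rfl⟩

theorem isOpen_image_lim (hτ : D.IsEquivariantTopology hD τ) {V : Set D.Cover}
    (hV : IsOpen[τ] V) : IsOpen (D.lim '' V) := by
  refine isOpen_iff_forall_mem_open.2 ?_
  rintro _ ⟨a, ha, rfl⟩
  obtain ⟨B, s, hs, haB, hsa⟩ := hτ.exists_isSheet a
  exact ⟨s ⁻¹' V ∩ B.carrier, fun y hy => ⟨s y, hy.1, hs.lim_apply y hy.2⟩,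
    hs.isOpen_preimage V hV, by rwa [mem_preimage, hsa], haB⟩

theorem lim_surjective (hτ : D.IsEquivariantTopology hD τ) : Function.Surjective D.lim := by
  obtain ⟨T, i, -, hT, hi, -⟩ := hτ.decomposition
  intro x
  obtain ⟨y, hxy, hyT⟩ := hT x
  have hx : x ∈ D.lam.leaf (D.lim (i ⟨y, hyT⟩)) := by
    rw [hi, ← leaf_eq_of_mem hxy]
    exact D.lam.mem_leaf_self x
  exact leaf_lim_subset_range _ hx

theorem exists_mapsTo_plaque (hτ : D.IsEquivariantTopology hD τ) {f : D.Cover → D.Cover}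
    (hf : Continuous[τ, τ] f) (hlim : ∀ a, D.lim (f a) = D.lim a) {a : D.Cover}
    (ha : D.lim a ∈ B.carrier) :
    ∃ B' : D.lam.FlowBox, D.lim a ∈ B'.carrier ∧ B'.carrier ⊆ B.carrier ∧
      MapsTo f (D.plaque B' a) (D.plaque B' (f a)) := by
  obtain ⟨B₁, s₁, hs₁, ha₁, hsa₁⟩ := hτ.exists_isSheet a
  obtain ⟨B₂, s₂, hs₂, ha₂, hsa₂⟩ := hτ.exists_isSheet (f a)
  rw [hlim] at ha₂
  obtain ⟨B', haB', hB'⟩ := FlowBox.exists_subset (𝓛 := D.lam)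
    ((flowBox_isOpen B).inter (hs₁.isOpen_setOf_apply_eq hs₂ hf hlim))
    ⟨ha, ha₁, ha₂, by rw [hsa₁, ← hlim a, hsa₂]⟩
  refine ⟨B', haB', fun x hx => (hB' hx).1, fun b hb => ?_⟩
  have hfb : f b = s₂ (D.lim b) := by
    obtain ⟨-, -, -, h⟩ := hB' (lim_mem_carrier hb)
    rwa [hs₁.apply_lim_of_mem_plaque hsa₁ (plaque_mono (fun x hx => (hB' hx).2.1) a hb)] at h
  obtain ⟨t, ht, hat, hbt⟩ := hb.1
  obtain ⟨c, hc, hcb⟩ := exists_mem_plaque_lim_eq ht ((hlim a).symm ▸ hat) hbt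
  have hsc : s₂ (D.lim c) = c :=
    hs₂.apply_lim_of_mem_plaque hsa₂ (plaque_mono (fun x hx => (hB' hx).2.2.1) _ hc)
  rwa [hfb, ← hcb, hsc]

theorem continuous_leafTop (hτ : D.IsEquivariantTopology hD τ) {f : D.Cover → D.Cover}
    (hf : Continuous[τ, τ] f) (hlim : ∀ a, D.lim (f a) = D.lim a) :
    Continuous[D.leafTop, D.leafTop] f := by
  refine continuous_generateFrom_iff.2 ?_
  rintro _ ⟨B, b, -, rfl⟩
  refine (@isOpen_iff_forall_mem_open _ D.leafTop _).2 fun a ha => ?_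
  obtain ⟨B', haB', hB', hf'⟩ := hτ.exists_mapsTo_plaque hf hlim (hlim a ▸ lim_mem_carrier ha)
  exact ⟨D.plaque B' a, fun c hc => plaque_trans ha (plaque_mono hB' _ (hf' hc)),
    isOpen_plaque haB', mem_plaque_self haB'⟩

theorem continuous_smul_leafTop (hτ : D.IsEquivariantTopology hD τ) (g : D.group hD) :
    Continuous[D.leafTop, D.leafTop] fun a : D.Cover => g • a :=
  hτ.continuous_leafTop (hτ.smul_continuous g) (D.lim_smul hD g)

end IsEquivariantTopology

end Sheet

section Automorphism

variable {n : ℕ} {X : Type*} [TopologicalSpace X] [T2Space X] {Lt : Type*} [TopologicalSpace Lt]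
  {G : Type*} [Group G] [MulAction G Lt] {D : GermData n X Lt G} {hD : D.IsGroup}
  {C : Subgroup (D.group hD)} {τ σ : TopologicalSpace D.Cover} {𝓜 : D.QuotLamination hD C σ}

theorem smul_eq_of_acts {g : D.group hD} {a b : D.Cover} (h : D.Acts g.1 a b) : g • a = b :=
  (hD.total g.1 g.2 a).unique (D.acts_smul hD g a) h

theorem IsTame.exists_smul_eq (hTame : D.IsTame) {a b : D.Cover} (h : D.lim a = D.lim b) :
    ∃ g : D.group hD, g • a = b := by
  obtain ⟨g, hg, hab⟩ := hTame a b h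
  exact ⟨⟨g, hg⟩, smul_eq_of_acts hab⟩

theorem toQuot_surjective : Function.Surjective (D.toQuot hD C) :=
  Quotient.exists_rep

theorem toQuot_eq_iff {a b : D.Cover} :
    D.toQuot hD C a = D.toQuot hD C b ↔ ∃ c : C, c • b = a :=
  Quotient.eq

theorem toQuot_smul (c : C) (a : D.Cover) : D.toQuot hD C (c • a) = D.toQuot hD C a :=
  toQuot_eq_iff.2 ⟨c, rfl⟩

theorem IsEquivariantTopology.isLocallyInjective_proj (hτ : D.IsEquivariantTopology hD τ) :
    @IsLocallyInjective (D.Quot hD C) X (D.quotLeafTop hD C) (D.proj hD C) := by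
  intro ξ
  obtain ⟨a, rfl⟩ := toQuot_surjective ξ
  obtain ⟨B, s, hs, haB, hsa⟩ := hτ.exists_isSheet a
  refine ⟨D.toQuot hD C '' D.plaque B a, ?_, mem_image_of_mem _ (mem_plaque_self haB), ?_⟩
  · let _ : TopologicalSpace D.Cover := D.leafTop
    have : ContinuousConstSMul C D.Cover := ⟨fun c => hτ.continuous_smul_leafTop c⟩
    exact isOpenMap_quotient_mk'_mul (Γ := C) _ (isOpen_plaque haB)
  · rintro _ ⟨b, hb, rfl⟩ _ ⟨c, hc, rfl⟩ h
    exact congrArg _ (hs.injOn_lim_plaque hsa hb hc h)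

namespace IsCandidate

theorem continuous_proj (hσ : D.IsCandidate hD C τ σ) :
    Continuous[D.quotTop hD C σ, inferInstance] (D.proj hD C) := by
  obtain ⟨𝓜, -, h, -⟩ := hσ.lamination
  exact h.continuous

theorem exists_dense_leaf (hσ : D.IsCandidate hD C τ σ) (𝓜 : D.QuotLamination hD C σ) :
    ∃ ξ, @Dense _ (D.quotTop hD C σ) (𝓜.lam.leaf ξ) := by
  obtain ⟨𝓜', hdense, -⟩ := hσ.lamination
  obtain ⟨a, ha⟩ := D.exists_lim_mem_leaf
  refine ⟨D.toQuot hD C a, ?_⟩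
  have h := hdense (D.toQuot hD C a) ha
  rwa [Lamination.leaf, 𝓜'.leafTopology_eq, ← 𝓜.leafTopology_eq] at h

end IsCandidate

theorem isQuotientMap_proj (hτ : D.IsEquivariantTopology hD τ) (hτσ : τ ≤ σ)
    (hproj : Continuous[D.quotTop hD C σ, inferInstance] (D.proj hD C)) :
    @IsQuotientMap _ _ (D.quotTop hD C σ) _ (D.proj hD C) := by
  let _ : TopologicalSpace D.Cover := σ
  let _ : TopologicalSpace (D.Quot hD C) := D.quotTop hD C σ
  have htoQuot : Continuous (D.toQuot hD C) := continuous_coinduced_rng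
  have hlim : IsOpenMap D.lim := fun V hV => hτ.isOpen_image_lim (hτσ V hV)
  exact IsQuotientMap.of_comp htoQuot hproj
    (hlim.isQuotientMap (hproj.comp htoQuot) hτ.lim_surjective)

section Normal

variable [C.Normal]

/-- The action of the fundamental germ on the quotient of the germ universal cover by a normal
subgroup `C`, which is induced by that on the germ universal cover. -/
noncomputable instance instMulActionQuot : MulAction (D.group hD) (D.Quot hD C) where
  smul g := Quotient.map (g • ·) (by
    rintro _ b ⟨c, rfl⟩
    refine ⟨MulAut.conjNormal g c, ?_⟩
    change (MulAut.conjNormal g c : D.group hD) • g • b = g • (c : D.group hD) • b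
    rw [MulAut.conjNormal_apply, smul_smul, smul_smul, inv_mul_cancel_right])
  one_smul ξ := by
    obtain ⟨a, rfl⟩ := toQuot_surjective ξ
    exact congrArg (D.toQuot hD C) (one_smul _ a)
  mul_smul g h ξ := by
    obtain ⟨a, rfl⟩ := toQuot_surjective ξ
    exact congrArg (D.toQuot hD C) (mul_smul g h a)

theorem proj_smul (g : D.group hD) (ξ : D.Quot hD C) : D.proj hD C (g • ξ) = D.proj hD C ξ := by
  obtain ⟨a, rfl⟩ := toQuot_surjective ξ
  exact D.lim_smul hD g a

theorem isHomeomorph_smul_coinduced {t : TopologicalSpace D.Cover}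
    (h : ∀ g : D.group hD, Continuous[t, t] fun a : D.Cover => g • a) (g : D.group hD) :
    @IsHomeomorph _ _ (t.coinduced (D.toQuot hD C)) (t.coinduced (D.toQuot hD C))
      (MulAction.toPerm g : Equiv.Perm (D.Quot hD C)) := by
  let _ : TopologicalSpace (D.Quot hD C) := t.coinduced (D.toQuot hD C)
  have hquot (g : D.group hD) : Continuous fun ξ : D.Quot hD C => g • ξ :=
    continuous_coinduced_dom.2 (continuous_coinduced_rng.comp (h g))
  exact (Equiv.isHomeomorph_iff _).2 ⟨hquot g, hquot g⁻¹⟩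

theorem isAutomorphism_toPerm (hτ : D.IsEquivariantTopology hD τ)
    (hσ : ∀ g : D.group hD, Continuous[σ, σ] fun a : D.Cover => g • a)
    (𝓜 : D.QuotLamination hD C σ) (g : D.group hD) : IsAutomorphism 𝓜 (MulAction.toPerm g) := by
  let _ : TopologicalSpace (D.Quot hD C) := D.quotTop hD C σ
  have hquot := isHomeomorph_smul_coinduced (C := C) hσ g
  have hleaf : @IsHomeomorph _ _ 𝓜.lam.leafTopology 𝓜.lam.leafTopology
      (MulAction.toPerm g : Equiv.Perm (D.Quot hD C)) := by
    rw [𝓜.leafTopology_eq]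
    exact isHomeomorph_smul_coinduced hτ.continuous_smul_leafTop g
  refine ⟨proj_smul g, hquot, hleaf, fun T => ?_, MulAut.conjNormal g, MulAction.toPerm g, ?_,
    fun a => rfl, fun c a => ?_⟩
  · exact Lamination.isTransversal_image_iff (hquot.homeomorph _) hleaf
  · exact (@Equiv.isHomeomorph_iff _ _ σ σ _).2 ⟨hσ g, hσ g⁻¹⟩
  · change g • (c : D.group hD) • a = (MulAut.conjNormal g c : D.group hD) • g • a
    rw [MulAut.conjNormal_apply, smul_smul, smul_smul, inv_mul_cancel_right]

/-- The homomorphism to the automorphism group of the covering `proj` given by the action of the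
fundamental germ on the quotient. -/
noncomputable def autHom (hτ : D.IsEquivariantTopology hD τ)
    (hσ : ∀ g : D.group hD, Continuous[σ, σ] fun a : D.Cover => g • a)
    (𝓜 : D.QuotLamination hD C σ) : D.group hD →* Aut D hD C 𝓜 :=
  (MulAction.toPermHom (D.group hD) (D.Quot hD C)).codRestrict _ (isAutomorphism_toPerm hτ hσ 𝓜)

variable (hτ : D.IsEquivariantTopology hD τ)
  (hσ : ∀ g : D.group hD, Continuous[σ, σ] fun a : D.Cover => g • a)

theorem autHom_apply (g : D.group hD) (ξ : D.Quot hD C) : (autHom hτ hσ 𝓜 g).1 ξ = g • ξ :=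
  rfl

theorem ker_autHom : (autHom hτ hσ 𝓜).ker = C := by
  ext g
  refine ⟨fun h => ?_, fun h => MonoidHom.mem_ker.2 (Subtype.ext (Equiv.ext fun ξ => ?_))⟩
  · obtain ⟨T, i, -, hT, -, -, -, hfree, -⟩ := hτ.decomposition
    obtain ⟨t, -, ht⟩ := hT (D.p D.xt)
    have hfix : g • D.toQuot hD C (i ⟨t, ht⟩) = D.toQuot hD C (i ⟨t, ht⟩) := by
      rw [← autHom_apply hτ hσ (𝓜 := 𝓜), MonoidHom.mem_ker.1 h]
      rfl
    obtain ⟨c, hc⟩ := toQuot_eq_iff.1 hfix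
    exact (hfree _ _ _ _ hc).1 ▸ c.2
  · obtain ⟨a, rfl⟩ := toQuot_surjective ξ
    exact toQuot_smul ⟨g, h⟩ a

theorem autHom_surjective (hTame : D.IsTame) (hT2 : @T2Space _ (D.quotTop hD C σ))
    (hdense : ∃ ξ, @Dense _ (D.quotTop hD C σ) (𝓜.lam.leaf ξ)) :
    Function.Surjective (autHom hτ hσ 𝓜) := by
  let _ : TopologicalSpace (D.Quot hD C) := D.quotTop hD C σ
  intro F
  obtain ⟨ξ, hξ⟩ := hdense
  obtain ⟨a, rfl⟩ := toQuot_surjective ξ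
  obtain ⟨b, hb⟩ := toQuot_surjective (F.1 (D.toQuot hD C a))
  have hlim : D.lim a = D.lim b :=
    (F.2.proj_eq (D.toQuot hD C a)).symm.trans (congrArg (D.proj hD C) hb.symm)
  obtain ⟨g, rfl⟩ := hTame.exists_smul_eq (hD := hD) hlim
  have hg := (autHom hτ hσ 𝓜 g).2
  have hproj : @IsLocallyInjective _ _ 𝓜.lam.leafTopology (D.proj hD C) :=
    𝓜.leafTopology_eq ▸ hτ.isLocallyInjective_proj
  refine ⟨g, Subtype.ext (DFunLike.coe_injective ?_)⟩
  refine Lamination.eq_of_comp_eq_of_dense_leaf hproj hg.isHomeomorph.continuous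
    F.2.isHomeomorph.continuous ?_ ?_ ?_ hξ hb
  · exact @IsHomeomorph.continuous _ _ 𝓜.lam.leafTopology 𝓜.lam.leafTopology _ hg.leaves
  · exact @IsHomeomorph.continuous _ _ 𝓜.lam.leafTopology 𝓜.lam.leafTopology _ F.2.leaves
  · exact funext fun η => (hg.proj_eq η).trans (F.2.proj_eq η).symm

include hτ hσ in
theorem orbitRel_aut_iff (hTame : D.IsTame) (ξ η : D.Quot hD C) :
    MulAction.orbitRel (Aut D hD C 𝓜) (D.Quot hD C) ξ η ↔ D.proj hD C ξ = D.proj hD C η := by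
  constructor
  · rintro ⟨F, rfl⟩
    exact F.2.proj_eq η
  · obtain ⟨a, rfl⟩ := toQuot_surjective ξ
    obtain ⟨b, rfl⟩ := toQuot_surjective η
    intro h
    obtain ⟨g, rfl⟩ := hTame.exists_smul_eq (hD := hD) (h.symm : D.lim b = D.lim a)
    exact ⟨autHom hτ hσ 𝓜 g, rfl⟩

end Normal

end Automorphism

end GermData

end GermLam

theorem mainTheorem12_general {n : ℕ} {X : Type*} [TopologicalSpace X] [T2Space X]
    {Lt : Type*} [TopologicalSpace Lt] {G : Type*} [Group G] [MulAction G Lt]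
    (D : GermLam.GermData n X Lt G) (hD : D.IsGroup) (hTame : D.IsTame)
    (τ : TopologicalSpace D.Cover) (hτ : D.IsEquivariantTopology hD τ)
    (C : Subgroup (D.group hD)) [C.Normal] (σ : TopologicalSpace D.Cover) (hτσ : τ ≤ σ)
    (hσ : ∀ g : D.group hD, Continuous[σ, σ] fun a : D.Cover => g • a)
    (hproj : Continuous[D.quotTop hD C σ, inferInstance] (D.proj hD C))
    (𝓜 : D.QuotLamination hD C σ) (hdense : ∃ ξ, @Dense _ (D.quotTop hD C σ) (𝓜.lam.leaf ξ))
    (hT2 : @T2Space (D.Quot hD C) (D.quotTop hD C σ)) :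
    (∃ e : (D.group hD ⧸ C) ≃* GermLam.GermData.Aut D hD C 𝓜,
      ∀ (g : D.group hD) (a : D.Cover),
        (e (g : D.group hD ⧸ C)).1 (D.toQuot hD C a) = D.toQuot hD C (g • a)) ∧
    ∃ f : MulAction.orbitRel.Quotient (GermLam.GermData.Aut D hD C 𝓜) (D.Quot hD C) → X,
      @IsHomeomorph _ _
        ((D.quotTop hD C σ).coinduced
          (Quotient.mk (MulAction.orbitRel (GermLam.GermData.Aut D hD C 𝓜) (D.Quot hD C)))) _ f ∧
      ∀ ξ : D.Quot hD C,
        f (Quotient.mk (MulAction.orbitRel (GermLam.GermData.Aut D hD C 𝓜) (D.Quot hD C)) ξ) =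
          D.proj hD C ξ := by
  constructor
  · have hsurj := GermLam.GermData.autHom_surjective hτ hσ hTame hT2 hdense
    have hker : C = (GermLam.GermData.autHom hτ hσ 𝓜).ker :=
      (GermLam.GermData.ker_autHom hτ hσ).symm
    exact ⟨QuotientGroup.liftEquiv C hsurj hker, fun g a => rfl⟩
  · let _ : TopologicalSpace (D.Quot hD C) := D.quotTop hD C σ
    have hquot : IsQuotientMap (D.proj hD C) := GermLam.GermData.isQuotientMap_proj hτ hτσ hproj
    exact ⟨_, GermLam.isHomeomorph_quotientLift hquot
      (GermLam.GermData.orbitRel_aut_iff hτ hσ hTame), fun ξ => rfl⟩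

theorem mainTheorem12 {n : ℕ} {X : Type*} [TopologicalSpace X] [T2Space X]
    [FirstCountableTopology X] {Lt : Type*} [TopologicalSpace Lt] {G : Type*} [Group G]
    [MulAction G Lt] (D : GermLam.GermData n X Lt G) (hD : D.IsGroup) (hTame : D.IsTame)
    (τ : TopologicalSpace D.Cover) (hτ : D.IsEquivariantTopology hD τ)
    (C : Subgroup (D.group hD)) [C.Normal]
    (σ : TopologicalSpace D.Cover) (hσ : D.IsCoveringTopology hD C τ σ)
    (𝓜 : D.QuotLamination hD C σ) (hT2 : @T2Space (D.Quot hD C) (D.quotTop hD C σ)) :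
    (∃ e : (D.group hD ⧸ C) ≃* GermLam.GermData.Aut D hD C 𝓜,
      ∀ (g : D.group hD) (a : D.Cover),
        (e (g : D.group hD ⧸ C)).1 (D.toQuot hD C a) = D.toQuot hD C (g • a)) ∧
    ∃ f : MulAction.orbitRel.Quotient (GermLam.GermData.Aut D hD C 𝓜) (D.Quot hD C) → X,
      @IsHomeomorph _ _
        ((D.quotTop hD C σ).coinduced
          (Quotient.mk (MulAction.orbitRel (GermLam.GermData.Aut D hD C 𝓜) (D.Quot hD C)))) _ f ∧
      ∀ ξ : D.Quot hD C,
        f (Quotient.mk (MulAction.orbitRel (GermLam.GermData.Aut D hD C 𝓜) (D.Quot hD C)) ξ) =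
          D.proj hD C ξ :=
  have h := hσ.isCandidate
  mainTheorem12_general D hD hTame τ hτ C σ h.id_open h.smul_continuous h.continuous_proj 𝓜
    (h.exists_dense_leaf 𝓜) hT2
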